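/- Let $\mathbf X$ and $\mathbf A$ be nonempty Borel spaces (Borel subsets of Polish spaces, with their Borel $\sigma$-algebras). Adjoin to $\mathbf X$ an isolated point $\Delta$ (the cemetery), $\mathbf X_\Delta=\mathbf X\cup\{\Delta\}$, and let $p(dy|x,a)$ be a stochastic kernel from $\mathbf X_\Delta\times\mathbf A$ to $\mathbf X_\Delta$ with $p(\{\Delta\}|\Delta,a)=1$ for all $a\in\mathbf A$. No further condition (in particular no semicontinuity) is imposed. Fix an initial state $x_0\in\mathbf X$ and an action $\hat a\in\mathbf A$. A strategy $\sigma=\{\sigma_n\}_{n\ge1}$ is a sequence of stochastic kernels $\sigma_n(da|x_0,a_1,\dots,x_{n-1})$ from $(\mathbf X_\Delta\times\mathbf A)^{n-1}\times\mathbf X_\Delta$ to $\mathbf A$ with $\sigma_n(\{\hat a\}|x_0,a_1,\dots,x_{n-1})=1$ whenever $x_{n-1}=\Delta$. It is deterministic stationary if there are a stochastic kernel $\sigma^s$ from $\mathbf X_\Delta$ to $\mathbf A$ and a measurable mapping $\varphi:\mathbf X_\Delta\to\mathbf A$ such that $\sigma_n(da|x_0,a_1,\dots,x_{n-1})=\sigma^s(da|x_{n-1})$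 for all $n$ and all histories, and $\sigma^s(\{\varphi(x)\}|x)=1$ for all $x\in\mathbf X_\Delta$; such a strategy is denoted by $\varphi$. Let $\mathsf P^\sigma_{x_0}$ be the law on $(\mathbf X_\Delta\times\mathbf A)^\infty$ of the process $X_0,A_1,X_1,A_2,\dots$ with $X_0=x_0$, in which $A_n$ has the conditional law $\sigma_n(da|X_0,A_1,\dots,X_{n-1})$ given $X_0,A_1,\dots,X_{n-1}$, and $X_n$ has the conditional law $p(dy|X_{n-1},A_n)$ given $X_0,A_1,\dots,X_{n-1},A_n$. The occupation measure of $\sigma$ is the measure on $\mathbf X\times\mathbf A$ given by $$\mathsf M^\sigma_{x_0}(dx\times da)=\sum_{n=1}^\infty\mathsf P^\sigma_{x_0}(X_{n-1}\in dx,\ A_n\in da).$$ Let $\mathcal D$ be the set of all occupation measures $\mathsf M^\sigma_{x_0}$ (with values in $[0,\infty]$), and let $\mathcal D^f=\{\mathsf M\in\mathcal D:\mathsf M(\mathbf X\times\mathbf A)<\infty\}$. An element $\mathsf M$ of $\mathcal D$ (resp. $\mathcal D^f$) is extreme in that set if $\mathsf M=\alpha\mathsf M_1+(1-\alpha)\mathsf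 M_2$ with $\alpha\in(0,1)$ and $\mathsf M_1,\mathsf M_2$ in the set implies $\mathsf M_1=\mathsf M_2=\mathsf M$. **Theorem.** An occupation measure $\mathsf M\in\mathcal D^f$ is an extreme point of $\mathcal D^f$ if and only if $\mathsf M=\mathsf M^\varphi_{x_0}$ for some deterministic stationary strategy $\varphi$. Moreover, if $\varphi$ is a deterministic stationary strategy with $\mathsf M^\varphi_{x_0}(\mathbf X\times\mathbf A)<\infty$, then $\mathsf M^\varphi_{x_0}$ is an extreme point of $\mathcal D$. -/

import Mathlib

open MeasureTheory ProbabilityTheory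
open scoped NNReal ENNReal

namespace CemeteryMDP

/-- The state space `X ∪ {Δ}`: the point `Δ` is adjoined to `X` as a disjoint (isolated) point.
The measurable sets are those whose trace on `X` is measurable, that is, the Borel sets of the
topological sum. -/
abbrev WithCemetery (X : Type*) : Type _ := X ⊕ Unit

/-- The cemetery `Δ`. -/
abbrev cemetery {X : Type*} : WithCemetery X := Sum.inr ()

/-- A (cost-free) Markov decision process with state space `X ∪ {Δ}`, action space `A` and an
absorbing cemetery `Δ`. -/
structure MDP (X A : Type*) [MeasurableSpace X] [MeasurableSpace A] where
  /-- The transition probability `p(dy | x, a)`. -/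
  p : Kernel (WithCemetery X × A) (WithCemetery X)
  isMarkovKernel : IsMarkovKernel p
  absorbing : ∀ a : A, p (cemetery, a) {cemetery} = 1

attribute [instance] MDP.isMarkovKernel

/-- Histories `(x₀, a₁, x₁, …, aₙ, xₙ)`, as elements of `(X_Δ × A)ⁿ × X_Δ`: the pairs are
`(x₀, a₁), …, (xₙ₋₁, aₙ)`, and the last component is the current state `xₙ`. -/
abbrev History (X A : Type*) (n : ℕ) : Type _ := (Fin n → WithCemetery X × A) × WithCemetery X

/-- A (randomized, history-dependent) strategy. The kernel `kernel n` is `σ_{n+1}`; it selects the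
action `a_{n+1}` given the history `(x₀, a₁, …, xₙ)`. In the cemetery the fixed action `aHat` is
chosen. -/
structure Strategy (X A : Type*) [MeasurableSpace X] [MeasurableSpace A] (aHat : A) where
  kernel : ∀ n : ℕ, Kernel (History X A n) A
  isMarkovKernel : ∀ n, IsMarkovKernel (kernel n)
  kernel_cemetery : ∀ (n : ℕ) (h : Fin n → WithCemetery X × A),
    kernel n (h, cemetery) {aHat} = 1

attribute [instance] Strategy.isMarkovKernel

section

variable {X A : Type*} [MeasurableSpace X] [MeasurableSpace A] {aHat : A}

/-- The strategy `σ` is stationary, given by the stochastic kernel `s` from `X_Δ` to `A`. -/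
def Strategy.IsStationaryWith (σ : Strategy X A aHat) (s : Kernel (WithCemetery X) A) : Prop :=
  IsMarkovKernel s ∧ ∀ (n : ℕ) (h : History X A n), σ.kernel n h = s h.2

/-- The strategy `σ` is deterministic stationary: it is stationary, and its kernel `s(da | x)` is
concentrated on `{φ x}` for a measurable mapping `φ` with values in `A`. -/
def Strategy.IsDeterministicStationary (σ : Strategy X A aHat) : Prop :=
  ∃ s : Kernel (WithCemetery X) A, σ.IsStationaryWith s ∧
    ∃ φ : WithCemetery X → A, Measurable φ ∧ ∀ x, s x {φ x} = 1

/-- The sample space: `ω n = (Xₙ, Aₙ₊₁)`. -/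
abbrev Sample (X A : Type*) : Type _ := ℕ → WithCemetery X × A

/-- The law of `(X₀, A₁)`: `X₀ = x₀`, and `A₁` has the law `σ₁(da | x₀)`. -/
noncomputable def initialLaw (σ : Strategy X A aHat) (x₀ : X) : Measure (WithCemetery X × A) :=
  (σ.kernel 0 (Fin.elim0, Sum.inl x₀)).map (fun a => (Sum.inl x₀, a))

instance (σ : Strategy X A aHat) (x₀ : X) : IsProbabilityMeasure (initialLaw σ x₀) :=
  Measure.isProbabilityMeasure_map (by fun_prop)

/-- The conditional law of `(Xₙ₊₁, Aₙ₊₂)` given `((x₀, a₁), …, (xₙ, aₙ₊₁))`: the state `y = xₙ₊₁`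
is drawn from `p(dy | xₙ, aₙ₊₁)`, and then the action from
`σₙ₊₂(da | x₀, a₁, …, xₙ, aₙ₊₁, y)`. -/
noncomputable def stepKernel (m : MDP X A) (σ : Strategy X A aHat) (n : ℕ) :
    Kernel (Finset.Iic n → WithCemetery X × A) (WithCemetery X × A) :=
  (m.p.comap (fun h : Finset.Iic n → WithCemetery X × A => h ⟨n, Finset.mem_Iic.2 le_rfl⟩)
      (by fun_prop)) ⊗ₖ
    ((σ.kernel (n + 1)).comap
      (fun q : (Finset.Iic n → WithCemetery X × A) × WithCemetery X =>
        ((fun i : Fin (n + 1) => q.1 ⟨i, Finset.mem_Iic.2 (Nat.lt_succ_iff.1 i.2)⟩, q.2) :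
          History X A (n + 1)))
      (by fun_prop))

instance (m : MDP X A) (σ : Strategy X A aHat) (n : ℕ) : IsMarkovKernel (stepKernel m σ n) := by
  unfold stepKernel; infer_instance

/-- The strategic measure `P^σ_{x₀}` on the sample space, from the Ionescu-Tulcea theorem. -/
noncomputable def strategicMeasure (m : MDP X A) (σ : Strategy X A aHat) (x₀ : X) :
    Measure (Sample X A) :=
  Kernel.trajMeasure (X := fun _ => WithCemetery X × A) (initialLaw σ x₀) (stepKernel m σ)

/-- The inclusion of `X × A` into `X_Δ × A`. -/
def inclusion (z : X × A) : WithCemetery X × A := (Sum.inl z.1, z.2)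

/-- The occupation measure `M^σ_{x₀}` on `X × A`, the sum over `n ≥ 1` of the measures
`P^σ_{x₀}(Xₙ₋₁ ∈ dx, Aₙ ∈ da)` restricted to `X × A`. -/
noncomputable def occupationMeasure (m : MDP X A) (σ : Strategy X A aHat) (x₀ : X) :
    Measure (X × A) :=
  Measure.sum fun n : ℕ =>
    ((strategicMeasure m σ x₀).map (fun ω : Sample X A => ω n)).comap inclusion

/-- The set `D` of all occupation measures with the initial state `x₀`. -/
def occupationMeasures (m : MDP X A) (aHat : A) (x₀ : X) : Set (Measure (X × A)) :=
  {M | ∃ σ : Strategy X A aHat, M = occupationMeasure m σ x₀}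

/-- The set `D^f` of all finite occupation measures with the initial state `x₀`. -/
def finiteOccupationMeasures (m : MDP X A) (aHat : A) (x₀ : X) : Set (Measure (X × A)) :=
  {M | M ∈ occupationMeasures m aHat x₀ ∧ M Set.univ < ∞}

theorem measurableEmbedding_inclusion :
    MeasurableEmbedding (inclusion : X × A → WithCemetery X × A) :=
  MeasurableEmbedding.prodMap
    ⟨Sum.inl_injective, measurable_inl, fun _ => measurableSet_inl_image.2⟩ MeasurableEmbedding.id

/-- The occupation measure of `ΓX × ΓA` is the expected number of `n ≥ 1` with
`Xₙ₋₁ ∈ ΓX` and `Aₙ ∈ ΓA`. -/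
theorem occupationMeasure_prod (m : MDP X A) (σ : Strategy X A aHat) (x₀ : X)
    {ΓX : Set X} {ΓA : Set A} (hX : MeasurableSet ΓX) (hA : MeasurableSet ΓA) :
    occupationMeasure m σ x₀ (ΓX ×ˢ ΓA) =
      ∫⁻ ω, ∑' n : ℕ, {ω : Sample X A | (ω n).1 ∈ Sum.inl '' ΓX ∧ (ω n).2 ∈ ΓA}.indicator 1 ω
        ∂(strategicMeasure m σ x₀) := by
  have hS : ∀ n : ℕ, MeasurableSet
      {ω : Sample X A | (ω n).1 ∈ Sum.inl '' ΓX ∧ (ω n).2 ∈ ΓA} := fun n =>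
    (hX.inl_image.preimage (by fun_prop)).inter
      (hA.preimage (by fun_prop))
  rw [lintegral_tsum fun n => (measurable_one.indicator (hS n)).aemeasurable,
    occupationMeasure, Measure.sum_apply _ (hX.prod hA)]
  refine tsum_congr fun n => ?_
  rw [lintegral_indicator_one (hS n), measurableEmbedding_inclusion.comap_apply,
    Measure.map_apply (by fun_prop)
      (measurableEmbedding_inclusion.measurableSet_image.2 (hX.prod hA))]
  congr 1
  ext ω
  constructor
  · rintro ⟨⟨x, a⟩, ⟨hx, ha⟩, h⟩
    exact ⟨⟨x, hx, congrArg Prod.fst h⟩, (congrArg Prod.snd h : a = _) ▸ ha⟩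
  · rintro ⟨⟨x, hx, h⟩, ha⟩
    exact ⟨(x, (ω n).2), ⟨hx, ha⟩, Prod.ext h rfl⟩

end

end CemeteryMDP

/-!
The argument rests on one fact about occupation measures,
`Strategy.IsInducedBy.occupationMeasure_eq`: if a *finite* occupation measure `M` disintegrates as
`M(dx, da) = μ(dx) r(da | x)`, then it is the occupation measure of the stationary strategy given
by `r`. Indeed `μ` satisfies the balance equation `μ = δ_{x₀} + μ K`, where `K` is the transition
kernel on `X` under `r`, while the state marginal of the stationary strategy is the least solution
of that equation (`Strategy.IsInducedBy.fst_occupationMeasure_le`). The difference `ρ` of the two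
is a finite invariant measure of `K` dominated by `μ`. Let `E` be the set where its density is
positive. Invariance and finiteness force `K(x, E) = 1` for `μ`-almost every `x ∈ E`, so the balance
equation, evaluated at `E`, leaves no mass for entering `E` from outside, nor for starting in it.
The original process therefore never visits `E`, that is `μ(E) = 0`, and `ρ = 0`
(`eq_zero_of_stateKernel_invariant`). No absorption hypothesis on the other strategies is needed.

*Deterministic stationary strategies give extreme points.* If `M^φ` is a proper convex combination
of occupation measures, then each of them is finite and concentrated on the graph of `φ`, hence is
disintegrated by the kernel `δ_{φ(x)}`, hence equals `M^φ`.

*Extreme points come from deterministic stationary strategies.* Let `M` be extreme and let `s` be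
its conditional kernel, so that `M` is the occupation measure of the stationary strategy `s`. If
`s` is the average of two kernels `r` and `r'`, then `M` is the average of the occupation measures
of the strategies which follow `s` except at one time `n`, where they use `r` or `r'`
(`occupationMeasure_deviation_add`). Both equal `M` by extremality. A deviation changes the
conditional law of the action at time `n` only, so `r = s` almost everywhere with respect to the
law of `Xₙ` (`occupationMeasure_deviation_add_compProd`), for every `n`. The splitting to use is the
one with densities `1 ± (g(a) - ∫ g ds(x))`, where `g` embeds `A` into `[0, 1]`: if it is trivial at
`x`, then `g` is `s(x)`-almost surely constant, so `s(x)` is a Dirac measure.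
-/

namespace CemeteryMDP

/-! ### The laws of the state-action pairs -/

variable {X A : Type*}

theorem extend_inclusion_inl (f : X × A → ℝ≥0∞) (x : X) (a : A) :
    Function.extend inclusion f 0 (Sum.inl x, a) = f (x, a) :=
  (Sum.inl_injective.prodMap Function.injective_id).extend_apply f 0 (x, a)

theorem extend_inclusion_inr (f : X × A → ℝ≥0∞) (u : Unit) (a : A) :
    Function.extend inclusion f 0 (Sum.inr u, a) = 0 :=
  Function.extend_apply' _ _ _ fun ⟨_, h⟩ => Sum.inl_ne_inr (congrArg Prod.fst h)

variable [MeasurableSpace X] [MeasurableSpace A] {aHat : A}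

/-- The sub-probability kernel from `X × A` to `X` given by the transitions that avoid the
cemetery. -/
noncomputable def MDP.transition (m : MDP X A) : Kernel (X × A) X :=
  (m.p.comap inclusion measurableEmbedding_inclusion.measurable).comapRight
    (MeasurableEmbedding.mk Sum.inl_injective measurable_inl
      fun _ => measurableSet_inl_image.2 : MeasurableEmbedding (Sum.inl : X → WithCemetery X))

theorem MDP.transition_apply (m : MDP X A) (z : X × A) {B : Set X} (hB : MeasurableSet B) :
    m.transition z B = m.p (Sum.inl z.1, z.2) (Sum.inl '' B) := by
  rw [MDP.transition, Kernel.comapRight_apply' _ _ _ hB, Kernel.comap_apply]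
  rfl

theorem MDP.transition_apply_le_one (m : MDP X A) (z : X × A) {B : Set X}
    (hB : MeasurableSet B) : m.transition z B ≤ 1 :=
  (m.transition_apply z hB).trans_le prob_le_one

instance (m : MDP X A) : IsFiniteKernel m.transition :=
  ⟨1, ENNReal.one_lt_top, fun z => m.transition_apply_le_one z .univ⟩

theorem MDP.p_cemetery_inl_image (m : MDP X A) (a : A) (B : Set X) :
    m.p (cemetery, a) (Sum.inl '' B) = 0 := by
  have hc : MeasurableSet ({cemetery} : Set (WithCemetery X)) := by
    simpa using (MeasurableSet.singleton ()).inr_image (α := X)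
  have h : m.p (cemetery, a) {cemetery}ᶜ = 0 := (prob_compl_eq_zero_iff hc).2 (m.absorbing a)
  refine measure_mono_null ?_ h
  rintro _ ⟨x, -, rfl⟩
  simp

/-- The measure `P^σ_{x₀}(Xₙ ∈ dx, Aₙ₊₁ ∈ da)` on `X × A`. -/
noncomputable def stepLaw (m : MDP X A) (σ : Strategy X A aHat) (x₀ : X) (n : ℕ) :
    Measure (X × A) :=
  ((strategicMeasure m σ x₀).map (fun ω : Sample X A => ω n)).comap inclusion

theorem occupationMeasure_eq_sum (m : MDP X A) (σ : Strategy X A aHat) (x₀ : X) :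
    occupationMeasure m σ x₀ = Measure.sum (stepLaw m σ x₀) := rfl

instance (m : MDP X A) (σ : Strategy X A aHat) (x₀ : X) :
    IsProbabilityMeasure (strategicMeasure m σ x₀) := by
  unfold strategicMeasure; infer_instance

instance (m : MDP X A) (σ : Strategy X A aHat) (x₀ : X) (n : ℕ) :
    IsFiniteMeasure (stepLaw m σ x₀ n) := by
  refine ⟨?_⟩
  rw [stepLaw, measurableEmbedding_inclusion.comap_apply]
  have := Measure.isProbabilityMeasure_map (μ := strategicMeasure m σ x₀)
    (f := fun ω : Sample X A => ω n) (measurable_pi_apply n).aemeasurable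
  exact measure_lt_top _ _

instance (m : MDP X A) (σ : Strategy X A aHat) (x₀ : X) :
    SFinite (occupationMeasure m σ x₀) := by
  rw [occupationMeasure_eq_sum]; infer_instance

theorem stepLaw_le_occupationMeasure (m : MDP X A) (σ : Strategy X A aHat) (x₀ : X) (n : ℕ) :
    stepLaw m σ x₀ n ≤ occupationMeasure m σ x₀ :=
  Measure.le_sum (stepLaw m σ x₀) n

theorem map_eval_zero_strategicMeasure (m : MDP X A) (σ : Strategy X A aHat) (x₀ : X) :
    (strategicMeasure m σ x₀).map (fun ω : Sample X A => ω 0) = initialLaw σ x₀ := by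
  have h : (fun ω : Sample X A => ω 0) =
      (MeasurableEquiv.piUnique fun _ : Finset.Iic 0 => WithCemetery X × A) ∘
        Preorder.frestrictLe (π := fun _ => WithCemetery X × A) 0 := rfl
  rw [h, ← Measure.map_map (by fun_prop) (by fun_prop), strategicMeasure, Kernel.trajMeasure,
    Measure.map_comp _ _ (by fun_prop), Kernel.traj_map_frestrictLe, Kernel.partialTraj_self,
    Measure.id_comp]
  rw [Measure.map_map (by fun_prop) (by fun_prop), MeasurableEquiv.self_comp_symm, Measure.map_id]

theorem map_eval_succ_strategicMeasure (m : MDP X A) (σ : Strategy X A aHat) (x₀ : X) (n : ℕ) :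
    (strategicMeasure m σ x₀).map (fun ω : Sample X A => ω (n + 1)) =
      stepKernel m σ n ∘ₘ (strategicMeasure m σ x₀).map
        (Preorder.frestrictLe (π := fun _ => WithCemetery X × A) n) := by
  have h := Kernel.map_frestrictLe_trajMeasure_compProd_eq_map_trajMeasure
    (X := fun _ => WithCemetery X × A) (μ₀ := initialLaw σ x₀) (κ := stepKernel m σ) (a := n)
  have h' := congrArg Measure.snd h
  have : IsProbabilityMeasure (Kernel.trajMeasure (X := fun _ => WithCemetery X × A)
    (initialLaw σ x₀) (stepKernel m σ)) := inferInstance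
  rw [Measure.snd_compProd, Measure.snd_map_prodMk (by fun_prop)] at h'
  exact h'.symm

/-- Integrals over `X × A` are taken on the sample space by extending the integrand by `0` to the
cemetery. -/
theorem lintegral_stepLaw (m : MDP X A) (σ : Strategy X A aHat) (x₀ : X) (n : ℕ)
    {f : X × A → ℝ≥0∞} (hf : Measurable f) :
    ∫⁻ z, f z ∂(stepLaw m σ x₀ n) =
      ∫⁻ ω, Function.extend inclusion f 0 (ω n) ∂(strategicMeasure m σ x₀) := by
  have hi := measurableEmbedding_inclusion (X := X) (A := A)
  have hm : Measurable (Function.extend inclusion f 0) := hi.measurable_extend hf measurable_zero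
  have h1 : ∀ z, f z = Function.extend inclusion f 0 (inclusion z) := fun z =>
    (hi.injective.extend_apply f 0 z).symm
  rw [lintegral_congr h1, stepLaw, ← hi.lintegral_map, hi.map_comap,
    setLIntegral_eq_of_support_subset ?_, lintegral_map hm (by fun_prop)]
  exact fun z hz => by_contra fun h => hz (Function.extend_apply' _ _ _ h)

/-- The integral with respect to the law of `(Xₙ₊₁, Aₙ₊₂)`, conditioned on the past. -/
theorem lintegral_stepLaw_succ (m : MDP X A) (σ : Strategy X A aHat) (x₀ : X) (n : ℕ)
    {f : X × A → ℝ≥0∞} (hf : Measurable f) :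
    ∫⁻ z, f z ∂(stepLaw m σ x₀ (n + 1)) =
      ∫⁻ h : Finset.Iic n → WithCemetery X × A,
        ∫⁻ y, ∫⁻ a, Function.extend inclusion f 0 (y, a)
          ∂(σ.kernel (n + 1)
            (fun i : Fin (n + 1) => h ⟨i, Finset.mem_Iic.2 (Nat.lt_succ_iff.1 i.2)⟩, y))
          ∂(m.p (h ⟨n, Finset.mem_Iic.2 le_rfl⟩))
        ∂((strategicMeasure m σ x₀).map
          (Preorder.frestrictLe (π := fun _ => WithCemetery X × A) n)) := by
  have hm : Measurable (Function.extend inclusion f 0) :=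
    measurableEmbedding_inclusion.measurable_extend hf measurable_zero
  rw [lintegral_stepLaw m σ x₀ (n + 1) hf,
    ← lintegral_map (g := fun ω : Sample X A => ω (n + 1)) hm (by fun_prop),
    map_eval_succ_strategicMeasure, Measure.lintegral_bind (by fun_prop) (by fun_prop)]
  refine lintegral_congr fun h => ?_
  rw [stepKernel, Kernel.lintegral_compProd _ _ _ hm]
  rfl

theorem lintegral_stepLaw_zero (m : MDP X A) (σ : Strategy X A aHat) (x₀ : X)
    {f : X × A → ℝ≥0∞} (hf : Measurable f) :
    ∫⁻ z, f z ∂(stepLaw m σ x₀ 0) = ∫⁻ a, f (x₀, a) ∂(σ.kernel 0 (Fin.elim0, Sum.inl x₀)) := by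
  have hm : Measurable (Function.extend inclusion f 0) :=
    measurableEmbedding_inclusion.measurable_extend hf measurable_zero
  rw [lintegral_stepLaw m σ x₀ 0 hf, ← lintegral_map (g := fun ω : Sample X A => ω 0) hm
    (by fun_prop), map_eval_zero_strategicMeasure, initialLaw, lintegral_map hm (by fun_prop)]
  simp only [extend_inclusion_inl]

theorem fst_stepLaw_zero (m : MDP X A) (σ : Strategy X A aHat) (x₀ : X) :
    (stepLaw m σ x₀ 0).fst = Measure.dirac x₀ := by
  ext B hB
  rw [Measure.fst_apply hB, ← lintegral_indicator_one (hB.preimage measurable_fst),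
    lintegral_stepLaw_zero m σ x₀ (measurable_one.indicator (hB.preimage measurable_fst)),
    Measure.dirac_apply' _ hB]
  by_cases h : x₀ ∈ B <;> simp [h]

/-- The state marginals propagate by the transitions within `X` alone: as the cemetery is absorbing,
it contributes nothing. -/
theorem fst_stepLaw_succ (m : MDP X A) (σ : Strategy X A aHat) (x₀ : X) (n : ℕ) :
    (stepLaw m σ x₀ (n + 1)).fst = m.transition ∘ₘ stepLaw m σ x₀ n := by
  ext B hB
  have hB' : MeasurableSet (Sum.inl '' B : Set (WithCemetery X)) := hB.inl_image
  have hm : Measurable fun h : Finset.Iic n → WithCemetery X × A =>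
      m.p (h ⟨n, Finset.mem_Iic.2 le_rfl⟩) (Sum.inl '' B) :=
    (m.p.measurable_coe hB').comp (g := fun z => m.p z (Sum.inl '' B))
      (f := fun h : Finset.Iic n → WithCemetery X × A => h ⟨n, Finset.mem_Iic.2 le_rfl⟩)
      (by fun_prop)
  have hind (h : History X A (n + 1)) : ∫⁻ a, Function.extend inclusion
      ((Prod.fst ⁻¹' B : Set (X × A)).indicator 1) 0 (h.2, a) ∂(σ.kernel (n + 1) h) =
        (Sum.inl '' B : Set (WithCemetery X)).indicator 1 h.2 := by
    obtain ⟨h, x | u⟩ := h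
    · by_cases hx : x ∈ B <;> simp [extend_inclusion_inl, hx]
    · simp [extend_inclusion_inr]
  have hext (z : WithCemetery X × A) : m.p z (Sum.inl '' B) =
      Function.extend inclusion (fun z => m.transition z B) 0 z := by
    obtain ⟨x | u, a⟩ := z
    · rw [extend_inclusion_inl, m.transition_apply _ hB]
    · rw [extend_inclusion_inr, m.p_cemetery_inl_image]
  rw [Measure.fst_apply hB, ← lintegral_indicator_one (hB.preimage measurable_fst),
    lintegral_stepLaw_succ m σ x₀ n (measurable_one.indicator (hB.preimage measurable_fst)),
    Measure.bind_apply hB (by fun_prop),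
    lintegral_stepLaw m σ x₀ n (m.transition.measurable_coe hB)]
  simp only [← hext]
  refine Eq.trans ?_ (lintegral_map (μ := strategicMeasure m σ x₀)
    (g := Preorder.frestrictLe (π := fun _ => WithCemetery X × A) n)
    (f := fun h => m.p (h ⟨n, Finset.mem_Iic.2 le_rfl⟩) (Sum.inl '' B)) hm (by fun_prop))
  refine lintegral_congr fun h => ?_
  rw [← lintegral_indicator_one hB']
  exact lintegral_congr fun y => hind (_, y)

/-- If the decision at time `n` depends on the current state only, through `r`, then `r` is the
conditional law of the action at that time given the state. -/
theorem stepLaw_eq_compProd (m : MDP X A) (σ : Strategy X A aHat) (x₀ : X) (n : ℕ)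
    (r : Kernel X A) [IsMarkovKernel r]
    (hr : ∀ (h : Fin n → WithCemetery X × A) (x : X), σ.kernel n (h, Sum.inl x) = r x) :
    stepLaw m σ x₀ n = (stepLaw m σ x₀ n).fst ⊗ₘ r := by
  ext S hS
  have hf : Measurable fun x => r x (Prod.mk x ⁻¹' S) := Kernel.measurable_kernel_prodMk_left hS
  have hf' : Measurable fun z : X × A => r z.1 (Prod.mk z.1 ⁻¹' S) := hf.comp measurable_fst
  have hx (x : X) : ∫⁻ a, S.indicator 1 (x, a) ∂(r x) = r x (Prod.mk x ⁻¹' S) := by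
    rw [← lintegral_indicator_one (hS.preimage measurable_prodMk_left)]
    rfl
  rw [Measure.compProd_apply hS, Measure.fst, lintegral_map hf measurable_fst,
    ← lintegral_indicator_one hS]
  cases n with
  | zero =>
    rw [lintegral_stepLaw_zero m σ x₀ (measurable_one.indicator hS),
      lintegral_stepLaw_zero m σ x₀ hf', hr, hx]
    simp
  | succ n =>
    rw [lintegral_stepLaw_succ m σ x₀ n (measurable_one.indicator hS),
      lintegral_stepLaw_succ m σ x₀ n hf']
    refine lintegral_congr fun h => lintegral_congr fun y => ?_
    obtain x | u := y
    · simp only [extend_inclusion_inl, hr, hx]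
      simp
    · simp only [extend_inclusion_inr]

/-! ### Balance equation and stationary strategies -/

/-- The balance equation, valid for every strategy. -/
theorem fst_occupationMeasure (m : MDP X A) (σ : Strategy X A aHat) (x₀ : X) :
    (occupationMeasure m σ x₀).fst =
      Measure.dirac x₀ + m.transition ∘ₘ occupationMeasure m σ x₀ := by
  have hb : m.transition ∘ₘ occupationMeasure m σ x₀ =
      Measure.sum fun n => m.transition ∘ₘ stepLaw m σ x₀ n := by
    rw [occupationMeasure_eq_sum, Measure.bind_sum _ _ m.transition.aemeasurable]
  rw [hb]
  ext B hB
  rw [occupationMeasure_eq_sum, Measure.fst_sum, Measure.add_apply, Measure.sum_apply _ hB,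
    Measure.sum_apply _ hB, tsum_eq_zero_add' ENNReal.summable, fst_stepLaw_zero]
  simp only [fst_stepLaw_succ]

/-- A strategy whose decisions in `X` are given by the Markov kernel `r`, whatever the time and
the past. -/
def Strategy.IsInducedBy (σ : Strategy X A aHat) (r : Kernel X A) : Prop :=
  ∀ (n : ℕ) (h : Fin n → WithCemetery X × A) (x : X), σ.kernel n (h, Sum.inl x) = r x

theorem Strategy.IsInducedBy.occupationMeasure_eq_compProd {σ : Strategy X A aHat}
    {r : Kernel X A} [IsMarkovKernel r] (hr : σ.IsInducedBy r) (m : MDP X A) (x₀ : X) :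
    occupationMeasure m σ x₀ = (occupationMeasure m σ x₀).fst ⊗ₘ r := by
  rw [occupationMeasure_eq_sum, Measure.fst_sum, Measure.compProd_sum_left]
  exact congrArg Measure.sum (funext fun n => stepLaw_eq_compProd m σ x₀ n r (hr n))

/-- The transition kernel on `X` of the state process when actions are drawn from `r`. -/
noncomputable def MDP.stateKernel (m : MDP X A) (r : Kernel X A) : Kernel X X :=
  m.transition ∘ₖ (Kernel.id ×ₖ r)

theorem MDP.transition_comp_compProd (m : MDP X A) (r : Kernel X A) [IsMarkovKernel r]
    (μ : Measure X) [SFinite μ] : m.transition ∘ₘ (μ ⊗ₘ r) = m.stateKernel r ∘ₘ μ := by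
  rw [Measure.compProd_eq_comp_prod, Measure.comp_assoc]; rfl

theorem MDP.stateKernel_apply_le_one (m : MDP X A) (r : Kernel X A) [IsMarkovKernel r] (x : X)
    {B : Set X} (hB : MeasurableSet B) : m.stateKernel r x B ≤ 1 := by
  rw [MDP.stateKernel, Kernel.comp_apply' _ _ _ hB]
  exact (lintegral_mono fun z => m.transition_apply_le_one z hB).trans (by simp)

/-- The state marginal of the occupation measure of the stationary strategy given by `r` is the
least solution of the balance equation `μ = δ_{x₀} + μ K_r`. -/
theorem Strategy.IsInducedBy.fst_occupationMeasure_le {σ : Strategy X A aHat}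
    {r : Kernel X A} [IsMarkovKernel r] (hr : σ.IsInducedBy r) (m : MDP X A) (x₀ : X)
    {μ : Measure X} (hμ : μ = Measure.dirac x₀ + m.stateKernel r ∘ₘ μ) :
    (occupationMeasure m σ x₀).fst ≤ μ := by
  have hstep (n : ℕ) : (stepLaw m σ x₀ (n + 1)).fst =
      m.stateKernel r ∘ₘ (stepLaw m σ x₀ n).fst := by
    rw [fst_stepLaw_succ, ← m.transition_comp_compProd,
      ← stepLaw_eq_compProd m σ x₀ n r (hr n)]
  -- The partial sums of the Neumann series `∑ δ_{x₀} Kⁿ` stay below any solution.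
  have hpart (N : ℕ) : ∑ n ∈ Finset.range N, (stepLaw m σ x₀ n).fst ≤ μ := by
    induction N with
    | zero => simpa using Measure.zero_le μ
    | succ N ih =>
      have hs : ∑ n ∈ Finset.range N, (stepLaw m σ x₀ (n + 1)).fst =
          m.stateKernel r ∘ₘ ∑ n ∈ Finset.range N, (stepLaw m σ x₀ n).fst := by
        clear ih
        induction N with
        | zero => simp
        | succ N ih =>
          rw [Finset.sum_range_succ, Finset.sum_range_succ, ih, Measure.comp_add, hstep]
      rw [Finset.sum_range_succ', hs, fst_stepLaw_zero, add_comm]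
      refine (add_le_add le_rfl (Measure.le_iff.2 fun B hB => ?_)).trans_eq hμ.symm
      rw [Measure.bind_apply hB (by fun_prop), Measure.bind_apply hB (by fun_prop)]
      exact lintegral_mono' ih le_rfl
  refine Measure.le_iff.2 fun B hB => ?_
  rw [occupationMeasure_eq_sum, Measure.fst_sum, Measure.sum_apply _ hB]
  refine ENNReal.tsum_le_of_sum_range_le fun N => ?_
  rw [← Measure.finsetSum_apply]
  exact hpart N B

/-- If almost every step from outside `E` stays outside `E`, and `x₀ ∉ E`, then `E` is
never visited. -/
theorem fst_occupationMeasure_eq_zero (m : MDP X A) (σ : Strategy X A aHat) (x₀ : X) {E : Set X}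
    (hE : MeasurableSet E) (hx₀ : x₀ ∉ E)
    (h : ∫⁻ z in Prod.fst ⁻¹' Eᶜ, m.transition z E ∂(occupationMeasure m σ x₀) = 0) :
    (occupationMeasure m σ x₀).fst E = 0 := by
  have hstep (n : ℕ) : (stepLaw m σ x₀ n).fst E = 0 := by
    induction n with
    | zero => rw [fst_stepLaw_zero, Measure.dirac_apply' _ hE]; simp [hx₀]
    | succ n ih =>
      have hE' : MeasurableSet (Prod.fst ⁻¹' E : Set (X × A)) := hE.preimage measurable_fst
      rw [Measure.fst_apply hE] at ih
      rw [fst_stepLaw_succ, Measure.bind_apply hE (by fun_prop), ← lintegral_add_compl _ hE',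
        setLIntegral_measure_zero _ _ ih, zero_add]
      refine le_antisymm (le_trans ?_ h.le) zero_le
      exact lintegral_mono' (Measure.restrict_mono le_rfl
        (stepLaw_le_occupationMeasure m σ x₀ n)) le_rfl
  rw [occupationMeasure_eq_sum, Measure.fst_sum, Measure.sum_apply _ hE]
  simp [hstep]

/-- If `r` disintegrates a finite occupation measure, then its state marginal dominates no nonzero
finite invariant measure of `stateKernel`: such a measure would be carried by a set which the
process cannot leave, so that reaching it with positive probability would make the occupation
measure infinite. -/
theorem eq_zero_of_stateKernel_invariant (m : MDP X A) (σ : Strategy X A aHat) (x₀ : X)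
    [IsFiniteMeasure (occupationMeasure m σ x₀)] {r : Kernel X A} [IsMarkovKernel r]
    (hM : occupationMeasure m σ x₀ = (occupationMeasure m σ x₀).fst ⊗ₘ r)
    {ρ : Measure X} [IsFiniteMeasure ρ] (hρ : ρ ≪ (occupationMeasure m σ x₀).fst)
    (hinv : m.stateKernel r ∘ₘ ρ = ρ) : ρ = 0 := by
  set M := occupationMeasure m σ x₀ with hMdef
  -- `E` carries `ρ`, and on `E` the null sets of `ρ` are null for the state marginal of `M`.
  let E : Set X := {x | ρ.rnDeriv M.fst x ≠ 0}
  have hE : MeasurableSet E := Measure.measurable_rnDeriv ρ M.fst (measurableSet_singleton 0).compl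
  have hEρ : ρ Eᶜ = 0 := by
    rw [← Measure.withDensity_rnDeriv_eq ρ M.fst hρ, withDensity_apply _ hE.compl]
    exact (setLIntegral_congr_fun hE.compl fun x hx => not_not.1 hx).trans (by simp)
  have hK1 : ∀ᵐ x ∂ρ, m.stateKernel r x E = 1 := by
    refine ae_eq_of_ae_le_of_lintegral_le
      (ae_of_all _ fun x => m.stateKernel_apply_le_one r x hE) ?_ aemeasurable_const ?_
    · exact ne_top_of_le_ne_top (measure_ne_top ρ Set.univ)
        ((lintegral_mono fun x => m.stateKernel_apply_le_one r x hE).trans (by simp))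
    · rw [← Measure.bind_apply hE (by fun_prop), hinv, lintegral_one,
        ← measure_add_measure_compl hE, hEρ, add_zero]
  have hK2 : ∀ᵐ x ∂M.fst, x ∈ E → m.stateKernel r x E = 1 :=
    Measure.ae_rnDeriv_ne_zero_imp_of_ae _ hK1
  have hE' : MeasurableSet (Prod.fst ⁻¹' E : Set (X × A)) := hE.preimage measurable_fst
  -- The mass which stays in `E` in one step is the whole mass of `E`.
  have hstay : ∫⁻ z in Prod.fst ⁻¹' E, m.transition z E ∂M = M.fst E := by
    have h : ∫⁻ z in Prod.fst ⁻¹' E, m.transition z E ∂M =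
        ∫⁻ x in E, m.stateKernel r x E ∂M.fst := by
      have : (Prod.fst ⁻¹' E : Set (X × A)) = E ×ˢ Set.univ := by ext; simp
      rw [hM, this, Measure.setLIntegral_compProd (m.transition.measurable_coe hE) hE .univ,
        Measure.fst_compProd]
      refine lintegral_congr fun x => ?_
      rw [MDP.stateKernel, Kernel.comp_apply' _ _ _ hE, Measure.restrict_univ,
        Kernel.prod_apply, Kernel.id_apply, Measure.dirac_prod,
        lintegral_map (m.transition.measurable_coe hE) (by fun_prop)]
    rw [h, setLIntegral_congr_fun_ae hE hK2]
    simp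
  have hbal : M.fst E = Measure.dirac x₀ E + (M.fst E +
      ∫⁻ z in Prod.fst ⁻¹' Eᶜ, m.transition z E ∂M) := by
    conv_lhs => rw [hMdef, fst_occupationMeasure, ← hMdef]
    rw [Measure.add_apply, Measure.bind_apply hE (by fun_prop), ← lintegral_add_compl _ hE', hstay]
    rfl
  -- Since `M.fst E` is finite, it cancels in the balance equation.
  have h0 : Measure.dirac x₀ E + ∫⁻ z in Prod.fst ⁻¹' Eᶜ, m.transition z E ∂M = 0 := by
    rw [add_left_comm] at hbal
    exact (ENNReal.add_right_inj (measure_ne_top M.fst E)).1 (by rw [← hbal, add_zero])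
  rw [add_eq_zero] at h0
  have hx₀ : x₀ ∉ E := by
    intro hx
    simp [Measure.dirac_apply' _ hE, hx] at h0
  have := hρ (fst_occupationMeasure_eq_zero m σ x₀ hE hx₀ h0.2)
  rw [← Measure.measure_univ_eq_zero, ← measure_add_measure_compl hE, this, hEρ, add_zero]

/-- A finite occupation measure is the occupation measure of every stationary strategy whose kernel
disintegrates it. Finiteness matters: the state marginal of `σ` is a solution of the balance
equation, but that of the stationary strategy is the least one. -/
theorem Strategy.IsInducedBy.occupationMeasure_eq {σ τ : Strategy X A aHat}
    {r : Kernel X A} [IsMarkovKernel r] (hτ : τ.IsInducedBy r) (m : MDP X A) (x₀ : X)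
    [IsFiniteMeasure (occupationMeasure m σ x₀)]
    (hM : occupationMeasure m σ x₀ = (occupationMeasure m σ x₀).fst ⊗ₘ r) :
    occupationMeasure m σ x₀ = occupationMeasure m τ x₀ := by
  have hN := hτ.occupationMeasure_eq_compProd m x₀
  set M := occupationMeasure m σ x₀ with hMdef
  set N := occupationMeasure m τ x₀ with hNdef
  have hMb : M.fst = Measure.dirac x₀ + m.stateKernel r ∘ₘ M.fst := by
    rw [← m.transition_comp_compProd, ← hM, hMdef, fst_occupationMeasure]
  have hNb : N.fst = Measure.dirac x₀ + m.stateKernel r ∘ₘ N.fst := by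
    rw [← m.transition_comp_compProd, ← hN, hNdef, fst_occupationMeasure]
  have hle : N.fst ≤ M.fst := hτ.fst_occupationMeasure_le m x₀ hMb
  have : IsFiniteMeasure N.fst := isFiniteMeasure_of_le _ hle
  have hsub : M.fst - N.fst + N.fst = M.fst := Measure.sub_add_cancel_of_le hle
  have hρ : M.fst - N.fst = 0 := by
    refine eq_zero_of_stateKernel_invariant m σ x₀ hM
      (Measure.absolutelyContinuous_of_le Measure.sub_le) ?_
    have h : m.stateKernel r ∘ₘ (M.fst - N.fst) + N.fst = M.fst - N.fst + N.fst := by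
      calc m.stateKernel r ∘ₘ (M.fst - N.fst) + N.fst
          = m.stateKernel r ∘ₘ (M.fst - N.fst) +
              (Measure.dirac x₀ + m.stateKernel r ∘ₘ N.fst) := by rw [← hNb]
        _ = Measure.dirac x₀ + m.stateKernel r ∘ₘ (M.fst - N.fst + N.fst) := by
            rw [Measure.comp_add, add_left_comm]
        _ = M.fst - N.fst + N.fst := by rw [hsub, ← hMb]
    have h' := congrArg (· - N.fst) h
    simpa only [Measure.add_sub_cancel] using h'
  rw [hM, hN, ← hsub, hρ, zero_add]

/-! ### Markov strategies and deviations at a single time -/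

section Markov

/-- The kernel from `X ∪ {Δ}` which is `r` on `X` and selects `aHat` in the cemetery. -/
noncomputable def extendKernel (aHat : A) (r : Kernel X A) : Kernel (WithCemetery X) A where
  toFun := Sum.elim r fun _ => Measure.dirac aHat
  measurable' := r.measurable.sumElim measurable_const

instance (r : Kernel X A) [IsMarkovKernel r] : IsMarkovKernel (extendKernel aHat r) := by
  refine ⟨fun y => ?_⟩
  obtain x | u := y
  · exact inferInstanceAs (IsProbabilityMeasure (r x))
  · exact inferInstanceAs (IsProbabilityMeasure (Measure.dirac aHat))

variable [MeasurableSingletonClass A]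

/-- The Markov strategy which selects its action in `X` at time `n` according to `r n`. -/
noncomputable def markovStrategy (aHat : A) (r : ℕ → Kernel X A) [∀ n, IsMarkovKernel (r n)] :
    Strategy X A aHat where
  kernel n := (extendKernel aHat (r n)).comap Prod.snd measurable_snd
  isMarkovKernel n := inferInstance
  kernel_cemetery n h := (Measure.dirac_apply' aHat (measurableSet_singleton aHat)).trans (by simp)

theorem markovStrategy_kernel_inl (r : ℕ → Kernel X A) [∀ n, IsMarkovKernel (r n)] (n : ℕ)
    (h : Fin n → WithCemetery X × A) (x : X) :
    (markovStrategy aHat r).kernel n (h, Sum.inl x) = r n x := rfl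

theorem isInducedBy_markovStrategy (r : Kernel X A) [IsMarkovKernel r] :
    (markovStrategy aHat fun _ => r).IsInducedBy r := fun _ _ _ => rfl

theorem isDeterministicStationary_markovStrategy {φ : X → A} (hφ : Measurable φ) :
    (markovStrategy aHat fun _ => Kernel.deterministic φ hφ).IsDeterministicStationary := by
  refine ⟨extendKernel aHat (Kernel.deterministic φ hφ), ⟨inferInstance, fun _ _ => rfl⟩,
    Sum.elim φ fun _ => aHat, hφ.sumElim measurable_const, fun y => ?_⟩
  obtain x | u := y
  · exact (Measure.dirac_apply' (φ x) (measurableSet_singleton _)).trans (by simp)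
  · exact (Measure.dirac_apply' aHat (measurableSet_singleton _)).trans (by simp)

instance isMarkovKernel_update (s r : Kernel X A) [IsMarkovKernel s] [IsMarkovKernel r] (n k : ℕ) :
    IsMarkovKernel (Function.update (fun _ => s) n r k) := by
  by_cases h : k = n
  · subst h; rwa [Function.update_self]
  · rwa [Function.update_of_ne h]

/-- The strategy which follows the stationary kernel `s`, except at time `n`, where it uses `r`. -/
noncomputable def deviation (aHat : A) (s r : Kernel X A) [IsMarkovKernel s] [IsMarkovKernel r]
    (n : ℕ) : Strategy X A aHat :=
  markovStrategy aHat (Function.update (fun _ => s) n r)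

section Deviation

variable (m : MDP X A) (x₀ : X) (s r r' : Kernel X A) [IsMarkovKernel s] [IsMarkovKernel r]
  [IsMarkovKernel r'] (n : ℕ)

theorem stepLaw_deviation_of_ne {k : ℕ} (h : k ≠ n) :
    stepLaw m (deviation aHat s r n) x₀ k = (stepLaw m (deviation aHat s r n) x₀ k).fst ⊗ₘ s := by
  refine stepLaw_eq_compProd m _ x₀ k s fun g x => ?_
  rw [deviation, markovStrategy_kernel_inl, Function.update_of_ne h]

theorem stepLaw_deviation_self :
    stepLaw m (deviation aHat s r n) x₀ n = (stepLaw m (deviation aHat s r n) x₀ n).fst ⊗ₘ r := by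
  refine stepLaw_eq_compProd m _ x₀ n r fun g x => ?_
  rw [deviation, markovStrategy_kernel_inl, Function.update_self]

theorem fst_stepLaw_deviation_of_le {k : ℕ} (h : k ≤ n) :
    (stepLaw m (deviation aHat s r n) x₀ k).fst =
      (stepLaw m (markovStrategy aHat fun _ => s) x₀ k).fst := by
  induction k with
  | zero => rw [fst_stepLaw_zero, fst_stepLaw_zero]
  | succ k ih =>
    rw [fst_stepLaw_succ, fst_stepLaw_succ, stepLaw_deviation_of_ne _ _ _ _ _ (by omega),
      ih (by omega), ← stepLaw_eq_compProd m _ x₀ k s fun _ _ => rfl]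

/-- The laws of the state-action pairs depend affinely on the kernel used at the single time `n`. -/
theorem stepLaw_deviation_add (h : r + r' = s + s) (k : ℕ) :
    stepLaw m (deviation aHat s r n) x₀ k + stepLaw m (deviation aHat s r' n) x₀ k =
      stepLaw m (markovStrategy aHat fun _ => s) x₀ k +
        stepLaw m (markovStrategy aHat fun _ => s) x₀ k := by
  have hσ (k : ℕ) := stepLaw_eq_compProd m (markovStrategy aHat fun _ => s) x₀ k s fun _ _ => rfl
  -- Equality of the state marginals yields the equality of the joint laws.
  have key (k : ℕ) (hk : (stepLaw m (deviation aHat s r n) x₀ k).fst +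
      (stepLaw m (deviation aHat s r' n) x₀ k).fst =
      (stepLaw m (markovStrategy aHat fun _ => s) x₀ k).fst +
        (stepLaw m (markovStrategy aHat fun _ => s) x₀ k).fst) :
      stepLaw m (deviation aHat s r n) x₀ k + stepLaw m (deviation aHat s r' n) x₀ k =
      stepLaw m (markovStrategy aHat fun _ => s) x₀ k +
        stepLaw m (markovStrategy aHat fun _ => s) x₀ k := by
    by_cases hkn : k = n
    · subst hkn
      have hr := stepLaw_deviation_self (aHat := aHat) m x₀ s r k
      have hr' := stepLaw_deviation_self (aHat := aHat) m x₀ s r' k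
      rw [fst_stepLaw_deviation_of_le _ _ _ _ _ le_rfl] at hr hr'
      rw [hr, hr', ← Measure.compProd_add_right, h, Measure.compProd_add_right, ← hσ]
    · have hs : stepLaw m (deviation aHat s r n) x₀ k + stepLaw m (deviation aHat s r' n) x₀ k =
          ((stepLaw m (deviation aHat s r n) x₀ k).fst +
            (stepLaw m (deviation aHat s r' n) x₀ k).fst) ⊗ₘ s := by
        rw [Measure.compProd_add_left, ← stepLaw_deviation_of_ne _ _ _ _ _ hkn,
          ← stepLaw_deviation_of_ne _ _ _ _ _ hkn]
      rw [hs, hk, Measure.compProd_add_left, ← hσ]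
  induction k with
  | zero => exact key 0 (by simp only [fst_stepLaw_zero])
  | succ k ih => exact key _ (by simp only [fst_stepLaw_succ, ← Measure.comp_add, ih])

theorem occupationMeasure_deviation_add (h : r + r' = s + s) :
    occupationMeasure m (deviation aHat s r n) x₀ + occupationMeasure m (deviation aHat s r' n) x₀ =
      occupationMeasure m (markovStrategy aHat fun _ => s) x₀ +
        occupationMeasure m (markovStrategy aHat fun _ => s) x₀ := by
  simp only [occupationMeasure_eq_sum, Measure.sum_add_sum, stepLaw_deviation_add m x₀ s r r' n h]

/-- The occupation measure of a deviation fails to be disintegrated by `s` by the contribution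
of the time `n` only. -/
theorem occupationMeasure_deviation_add_compProd :
    occupationMeasure m (deviation aHat s r n) x₀ +
        (stepLaw m (markovStrategy aHat fun _ => s) x₀ n).fst ⊗ₘ s =
      (occupationMeasure m (deviation aHat s r n) x₀).fst ⊗ₘ s +
        (stepLaw m (markovStrategy aHat fun _ => s) x₀ n).fst ⊗ₘ r := by
  rw [← fst_stepLaw_deviation_of_le m x₀ s r n le_rfl, ← stepLaw_deviation_self,
    occupationMeasure_eq_sum, Measure.fst_sum, Measure.compProd_sum_left]
  ext B hB
  simp only [Measure.add_apply, Measure.sum_apply _ hB]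
  rw [ENNReal.tsum_eq_add_tsum_ite n, ENNReal.tsum_eq_add_tsum_ite (f := fun k =>
    ((stepLaw m (deviation aHat s r n) x₀ k).fst ⊗ₘ s) B) n]
  rw [add_right_comm, add_right_comm _ _ (stepLaw m (deviation aHat s r n) x₀ n B),
    add_comm (stepLaw m (deviation aHat s r n) x₀ n B)]
  congr 1
  refine tsum_congr fun k => ?_
  split_ifs with hk
  · rfl
  · rw [← stepLaw_deviation_of_ne _ _ _ _ _ hk]

end Deviation

end Markov

/-! ### Splitting a kernel by tilting -/

theorem eq_dirac_of_ae_eq {μ : Measure A} [IsProbabilityMeasure μ] {c : A}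
    (h : ∀ᵐ a ∂μ, a = c) : μ = Measure.dirac c := by
  have h' : (fun a : A => a) =ᵐ[μ] fun _ => c := h
  calc μ = μ.map fun a => a := Measure.map_id.symm
    _ = Measure.dirac c := by rw [Measure.map_congr h', Measure.map_const, measure_univ, one_smul]

/-- The density on `A`, relative to `s(da | x)`, which shifts the mass of `s` towards large values
of `g` by adding the deviation of `g` from its mean under `s(da | x)`. -/
noncomputable def tilt (s : Kernel X A) (g : A → ℝ) (x : X) (a : A) : ℝ≥0∞ :=
  ENNReal.ofReal (1 + (g a - ∫ b, g b ∂(s x)))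

theorem measurable_tilt (s : Kernel X A) [IsMarkovKernel s] {g : A → ℝ} (hg : Measurable g) :
    Measurable (Function.uncurry (tilt s g)) := by
  have h : Measurable fun x => ∫ b, g b ∂(s x) :=
    (hg.stronglyMeasurable.integral_kernel (κ := s)).measurable
  unfold tilt
  exact (measurable_const.add ((hg.comp measurable_snd).sub (h.comp measurable_fst))).ennreal_ofReal

theorem integrable_of_mem_Icc {μ : Measure A} [IsProbabilityMeasure μ] {g : A → ℝ}
    (hg : Measurable g) (h01 : ∀ a, g a ∈ Set.Icc (0 : ℝ) 1) : Integrable g μ :=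
  Integrable.of_mem_Icc 0 1 hg.aemeasurable (ae_of_all _ h01)

theorem integral_mem_Icc (μ : Measure A) [IsProbabilityMeasure μ] {g : A → ℝ}
    (hg : Measurable g) (h01 : ∀ a, g a ∈ Set.Icc (0 : ℝ) 1) : ∫ a, g a ∂μ ∈ Set.Icc (0 : ℝ) 1 :=
  ⟨integral_nonneg fun a => (h01 a).1, by
    simpa using integral_mono (integrable_of_mem_Icc (μ := μ) hg h01) (integrable_const 1)
      fun a => (h01 a).2⟩

theorem isMarkovKernel_withDensity_tilt (s : Kernel X A) [IsMarkovKernel s] {g : A → ℝ}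
    (hg : Measurable g) (hint : ∀ x, Integrable g (s x))
    (hle : ∀ x a, 0 ≤ 1 + (g a - ∫ b, g b ∂(s x))) : IsMarkovKernel (s.withDensity (tilt s g)) := by
  refine ⟨fun x => ⟨?_⟩⟩
  rw [Kernel.withDensity_apply' s (measurable_tilt s hg), Measure.restrict_univ]
  have hi : Integrable (fun a => g a - ∫ b, g b ∂(s x)) (s x) :=
    (hint x).sub (integrable_const _)
  simp only [tilt]
  have hi' : Integrable (fun a => 1 + (g a - ∫ b, g b ∂(s x))) (s x) := (integrable_const 1).add hi
  rw [← ofReal_integral_eq_lintegral_ofReal hi' (ae_of_all _ (hle x)),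
    integral_add (integrable_const 1) hi, integral_sub (hint x) (integrable_const _)]
  simp

/-- Tilting by `g` and by `-g` splits `s` into two halves. The bounds on `g` keep the two densities
nonnegative, so that `ENNReal.ofReal` does not truncate them. -/
theorem withDensity_tilt_add_neg (s : Kernel X A) [IsMarkovKernel s] {g : A → ℝ}
    (hg : Measurable g) (h01 : ∀ a, g a ∈ Set.Icc (0 : ℝ) 1) :
    s.withDensity (tilt s g) + s.withDensity (tilt s (-g)) = s + s := by
  ext1 x
  have hsum : tilt s g x + tilt s (-g) x = fun _ => 2 := by
    funext a
    obtain ⟨h0, h1⟩ := integral_mem_Icc (s x) hg h01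
    rw [Pi.add_apply, tilt, tilt, integral_neg', Pi.neg_apply,
      ← ENNReal.ofReal_add (by linarith [(h01 a).1]) (by linarith [(h01 a).2])]
    ring_nf
    simp
  rw [add_apply, add_apply, Kernel.withDensity_apply s (measurable_tilt s hg),
    Kernel.withDensity_apply s (measurable_tilt s hg.neg), ← withDensity_add_left
      (measurable_tilt s hg).of_uncurry_left, hsum, withDensity_const, two_smul]

/-- If tilting by `g` has no effect at `x`, then `g` is `s(x)`-almost surely equal to its mean. -/
theorem ae_eq_integral_of_withDensity_tilt_eq (s : Kernel X A) [IsMarkovKernel s] {g : A → ℝ}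
    (hg : Measurable g) {x : X}
    (h : s.withDensity (tilt s g) x = s x) : ∀ᵐ a ∂(s x), g a = ∫ b, g b ∂(s x) := by
  rw [Kernel.withDensity_apply s (measurable_tilt s hg)] at h
  have h' : tilt s g x =ᵐ[s x] 1 := by
    rw [← withDensity_eq_iff_of_sigmaFinite (measurable_tilt s hg).of_uncurry_left.aemeasurable
      measurable_one.aemeasurable, h, withDensity_one]
  filter_upwards [h'] with a ha
  simp only [tilt, Pi.one_apply, ENNReal.ofReal_eq_one] at ha
  linarith

theorem exists_measurable_ae_eq_deterministic [StandardBorelSpace A] [Nonempty A] (μ : Measure X)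
    (s : Kernel X A) [IsMarkovKernel s] {g : A → ℝ} (hg : MeasurableEmbedding g)
    (h : ∀ᵐ x ∂μ, ∀ᵐ a ∂(s x), g a = ∫ b, g b ∂(s x)) :
    ∃ (φ : X → A) (hφ : Measurable φ), s =ᵐ[μ] Kernel.deterministic φ hφ := by
  have ht : Measurable fun x => ∫ b, g b ∂(s x) :=
    (hg.measurable.stronglyMeasurable.integral_kernel (κ := s)).measurable
  refine ⟨fun x => hg.invFun (∫ b, g b ∂(s x)), hg.measurable_invFun.comp ht, ?_⟩
  filter_upwards [h] with x hx
  refine eq_dirac_of_ae_eq ?_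
  filter_upwards [hx] with a ha
  rw [← ha, hg.leftInverse_invFun]

/-! ### Extreme occupation measures -/

/-- If the occupation measure of a stationary strategy is extreme, then every splitting of its
kernel into two halves is trivial. -/
theorem ae_eq_of_mem_extremePoints [StandardBorelSpace A] (m : MDP X A) (x₀ : X)
    (s r r' : Kernel X A) [IsMarkovKernel s] [IsMarkovKernel r] [IsMarkovKernel r']
    (h : r + r' = s + s)
    (hM : occupationMeasure m (markovStrategy aHat fun _ => s) x₀ ∈
      Set.extremePoints ℝ≥0 (finiteOccupationMeasures m aHat x₀)) :
    ∀ᵐ x ∂(occupationMeasure m (markovStrategy aHat fun _ => s) x₀).fst, r x = s x := by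
  have : Nonempty A := ⟨aHat⟩
  rw [mem_extremePoints_iff_left] at hM
  obtain ⟨⟨-, hfin⟩, hext⟩ := hM
  have : IsFiniteMeasure (occupationMeasure m (markovStrategy aHat fun _ => s) x₀) := ⟨hfin⟩
  rw [occupationMeasure_eq_sum, Measure.fst_sum, Measure.ae_sum_iff]
  -- The state marginal is the sum of the laws of `Xₙ`, so each time `n` can be treated separately.
  intro n
  have hadd := occupationMeasure_deviation_add (aHat := aHat) m x₀ s r r' n h
  have hlt : occupationMeasure m (deviation aHat s r n) x₀ Set.univ +
      occupationMeasure m (deviation aHat s r' n) x₀ Set.univ < ∞ := by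
    rw [← Measure.add_apply, hadd]
    exact measure_lt_top _ _
  rw [ENNReal.add_lt_top] at hlt
  have heq : occupationMeasure m (deviation aHat s r n) x₀ =
      occupationMeasure m (markovStrategy aHat fun _ => s) x₀ := by
    refine hext _ ⟨⟨_, rfl⟩, hlt.1⟩ _ ⟨⟨_, rfl⟩, hlt.2⟩ ⟨2⁻¹, 2⁻¹, by simp, by simp, ?_, ?_⟩
    · rw [← two_mul, mul_inv_cancel₀ two_ne_zero]
    · rw [← smul_add, hadd, ← two_smul ℝ≥0, smul_smul, inv_mul_cancel₀ two_ne_zero, one_smul]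
  have hdev := occupationMeasure_deviation_add_compProd (aHat := aHat) m x₀ s r n
  rw [heq, ← (isInducedBy_markovStrategy s).occupationMeasure_eq_compProd m x₀,
    add_comm, add_comm (occupationMeasure _ _ _)] at hdev
  -- With `M` in place of the deviation, the terms away from time `n` cancel.
  have hc := congrArg (· - occupationMeasure m (markovStrategy aHat fun _ => s) x₀) hdev
  simp only [Measure.add_sub_cancel] at hc
  exact Kernel.ae_eq_of_compProd_eq hc.symm

theorem exists_deterministic_of_mem_extremePoints [StandardBorelSpace A] (m : MDP X A) (x₀ : X)
    {M : Measure (X × A)}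
    (hM : M ∈ Set.extremePoints ℝ≥0 (finiteOccupationMeasures m aHat x₀)) :
    ∃ φ : Strategy X A aHat, φ.IsDeterministicStationary ∧ M = occupationMeasure m φ x₀ := by
  have : Nonempty A := ⟨aHat⟩
  obtain ⟨⟨σ, rfl⟩, hfin⟩ := hM.1
  have : IsFiniteMeasure (occupationMeasure m σ x₀) := ⟨hfin⟩
  set s := (occupationMeasure m σ x₀).condKernel
  have hdis : occupationMeasure m σ x₀ = (occupationMeasure m σ x₀).fst ⊗ₘ s :=
    ((occupationMeasure m σ x₀).disintegrate s).symm
  have hs : occupationMeasure m σ x₀ = occupationMeasure m (markovStrategy aHat fun _ => s) x₀ :=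
    (isInducedBy_markovStrategy s).occupationMeasure_eq m x₀ hdis
  let g : A → ℝ := fun a => Real.sigmoid (embeddingReal A a)
  have hg : MeasurableEmbedding g :=
    (continuous_sigmoid.measurable.comp
      (measurableEmbedding_embeddingReal A).measurable).measurableEmbedding
      (Real.sigmoid_injective.comp (measurableEmbedding_embeddingReal A).injective)
  have h01 (a : A) : g a ∈ Set.Icc (0 : ℝ) 1 := ⟨Real.sigmoid_nonneg _, Real.sigmoid_le_one _⟩
  have hI (x : X) := integral_mem_Icc (s x) hg.measurable h01
  have hint (x : X) : Integrable g (s x) := integrable_of_mem_Icc hg.measurable h01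
  have := isMarkovKernel_withDensity_tilt s hg.measurable hint fun x a => by
    linarith [(h01 a).1, (hI x).2]
  have := isMarkovKernel_withDensity_tilt s hg.measurable.neg (fun x => (hint x).neg) fun x a => by
    simp only [integral_neg, Pi.neg_apply]
    linarith [(h01 a).2, (hI x).1]
  have hae := ae_eq_of_mem_extremePoints m x₀ s _ _
    (withDensity_tilt_add_neg s hg.measurable h01) (hs ▸ hM)
  rw [← hs] at hae
  obtain ⟨φ, hφ, hsφ⟩ := exists_measurable_ae_eq_deterministic (occupationMeasure m σ x₀).fst s hg
    (hae.mono fun x hx => ae_eq_integral_of_withDensity_tilt_eq s hg.measurable hx)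
  refine ⟨_, isDeterministicStationary_markovStrategy hφ,
    (isInducedBy_markovStrategy _).occupationMeasure_eq m x₀ ?_⟩
  rw [← Measure.compProd_congr hsφ, ← hdis]

theorem mem_extremePoints_of_isDeterministicStationary [StandardBorelSpace A] (m : MDP X A) (x₀ : X)
    {τ : Strategy X A aHat} (hτ : τ.IsDeterministicStationary)
    (hfin : occupationMeasure m τ x₀ Set.univ < ∞) :
    occupationMeasure m τ x₀ ∈ Set.extremePoints ℝ≥0 (occupationMeasures m aHat x₀) := by
  obtain ⟨s, ⟨hs, hτs⟩, φ, hφ, hsφ⟩ := hτ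
  have hψ : Measurable fun x : X => φ (Sum.inl x) := hφ.comp measurable_inl
  have hind : τ.IsInducedBy (Kernel.deterministic _ hψ) := by
    intro n h x
    rw [hτs, Kernel.deterministic_apply]
    exact eq_dirac_of_ae_eq ((mem_ae_iff_prob_eq_one (measurableSet_singleton _)).2 (hsφ _))
  have hgraph : MeasurableSet {z : X × A | z.2 = φ (Sum.inl z.1)} :=
    measurableSet_eq_fun measurable_snd (hψ.comp measurable_fst)
  have hM : ∀ᵐ z ∂(occupationMeasure m τ x₀), z.2 = φ (Sum.inl z.1) := by
    rw [hind.occupationMeasure_eq_compProd, Measure.compProd_deterministic,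
      ae_map_iff (by fun_prop) hgraph]
    simp
  rw [mem_extremePoints_iff_left]
  refine ⟨⟨τ, rfl⟩, ?_⟩
  rintro _ ⟨σ, rfl⟩ M₂ - ⟨a, b, ha, hb, -, hab⟩
  have hle : a • occupationMeasure m σ x₀ ≤ occupationMeasure m τ x₀ := by
    rw [← hab]
    exact Measure.le_add_right le_rfl
  have hac : occupationMeasure m σ x₀ ≪ occupationMeasure m τ x₀ :=
    (Measure.absolutelyContinuous_smul (ENNReal.coe_ne_zero.2 ha.ne')).trans
      (Measure.absolutelyContinuous_of_le hle)
  have : IsFiniteMeasure (occupationMeasure m σ x₀) := by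
    refine ⟨lt_top_iff_ne_top.2 fun htop => (hle Set.univ |>.trans_lt hfin).ne ?_⟩
    rw [Measure.smul_apply, htop, ENNReal.smul_top, if_neg ha.ne']
  refine hind.occupationMeasure_eq m x₀ ?_
  rw [Measure.compProd_deterministic, Measure.fst, Measure.map_map (by fun_prop) (by fun_prop)]
  exact Measure.map_id.symm.trans (Measure.map_congr
    (hac.ae_le (hM.mono fun z hz => Prod.ext rfl hz)))

end CemeteryMDP

theorem theorem4p1 {X A : Type*} [MeasurableSpace X] [StandardBorelSpace X]
    [MeasurableSpace A] [StandardBorelSpace A]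
    (m : CemeteryMDP.MDP X A) (aHat : A) (x₀ : X) :
    (∀ M ∈ CemeteryMDP.finiteOccupationMeasures m aHat x₀,
      M ∈ Set.extremePoints ℝ≥0 (CemeteryMDP.finiteOccupationMeasures m aHat x₀) ↔
        ∃ φ : CemeteryMDP.Strategy X A aHat, φ.IsDeterministicStationary ∧
          M = CemeteryMDP.occupationMeasure m φ x₀) ∧
    (∀ φ : CemeteryMDP.Strategy X A aHat, φ.IsDeterministicStationary →
      CemeteryMDP.occupationMeasure m φ x₀ Set.univ < ∞ →
      CemeteryMDP.occupationMeasure m φ x₀ ∈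
        Set.extremePoints ℝ≥0 (CemeteryMDP.occupationMeasures m aHat x₀)) := by
  refine ⟨fun M hM => ⟨CemeteryMDP.exists_deterministic_of_mem_extremePoints m x₀, ?_⟩,
    fun φ => CemeteryMDP.mem_extremePoints_of_isDeterministicStationary m x₀⟩
  rintro ⟨φ, hφ, rfl⟩
  exact inter_extremePoints_subset_extremePoints_of_subset (fun _ h => h.1)
    ⟨hM, CemeteryMDP.mem_extremePoints_of_isDeterministicStationary m x₀ hφ hM.2⟩
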